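/- Let $G=H_1\ast\cdots\ast H_p\ast F_k$ be a free product of subgroups $H_1,\dots,H_p$ and a free group $F_k$ of rank $k$. Let $T$ be a metric simplicial tree with vertex set $V$, on which $G$ acts by simplicial isometries, such that: (0) no vertex is redundant (a vertex $v$ is redundant if it has valence $2$ and every $g\in G$ fixing $v$ fixes every edge incident to $v$); (1) the action has no global fixed point and is minimal (there is no proper non-empty $G$-invariant subtree); (2) edge stabilizers are trivial and there are finitely many $G$-orbits of edges; (3) every conjugate of every $H_i$ fixes exactly one vertex, and the stabilizer of each vertex is either trivial or a conjugate of some $H_i$. Let $\phi:G\to G$ be an injective endomorphism, and let $f:T\to T$ be a train track map representing $\phi$ with stretch factor $\lambda\ge 1$, that is: (a) $f(gx)=\phi(g)f(x)$ for all $g\in G$, $x\in T$, and $f(V)\subseteq V$; (b) $f$ maps each edge $e$ injectively and linearly onto an edge path of length $\lambda\cdot\mathrm{length}(e)$; (c) call a turn at a vertex $v$ (a pair of edges $e,e'$ starting at $v$) illegal if $f(e)$ and $f(e')$ have a common non-degenerate initial segment, and legal otherwise; then at every vertex there is a legal turn, for every edge $e$ all turns crossed by the path $f(e)$ are legal, and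 for every legal turn $(e,e')$ the turn formed by the first edges of $f(e)$ and $f(e')$ is legal. Then for all $x,y\in T$ the limit $$d_\infty(x,y)=\lim_{n\to\infty}\frac{d_T(f^n(x),f^n(y))}{\lambda^n}$$ exists. Let $T_\infty$ be the metric space obtained from the pseudo-metric space $(T,d_\infty)$ by identifying points $x,x'$ with $d_\infty(x,x')=0$, with the isometric action of $G$ induced from $T$. Then $T_\infty$ is an $\mathbb{R}$-tree, and the $G$-action on $T_\infty$ has trivial arc stabilizers: if $c\subset T_\infty$ is an arc (a subset homeomorphic to $[0,1]$) and $g\in G$ fixes every point of $c$, then $g=1$. -/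

import Mathlib

open Filter Topology Set

/-! ### Metric trees -/

/-- The segment `[x, y]`: the points lying metrically between `x` and `y`. -/
def seg {X : Type*} [MetricSpace X] (x y : X) : Set X :=
  {z | dist x z + dist z y = dist x y}

/-- An `ℝ`-tree: a nonempty geodesic metric space that is `0`-hyperbolic (four-point condition). -/
structure IsRTree (X : Type*) [MetricSpace X] : Prop where
  nonempty : Nonempty X
  geodesic : ∀ x y : X, ∃ γ : ℝ → X, γ 0 = x ∧ γ (dist x y) = y ∧
    ∀ s ∈ Icc 0 (dist x y), ∀ t ∈ Icc 0 (dist x y), dist (γ s) (γ t) = |s - t|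
  four_point : ∀ x y z w : X,
    dist x y + dist z w ≤ max (dist x z + dist y w) (dist x w + dist y z)

/-- `(u, v)` is an (oriented) edge for the vertex set `V`: two distinct vertices with no other
vertex between them. The edge itself is the segment `seg u v`. -/
def IsEdge {X : Type*} [MetricSpace X] (V : Set X) (u v : X) : Prop :=
  u ≠ v ∧ seg u v ∩ V = {u, v}

/-- A metric simplicial tree with vertex set `V`. -/
structure IsSimplicialTree (X : Type*) [MetricSpace X] (V : Set X) : Prop where
  isRTree : IsRTree X
  finite_vertices : ∀ x y : X, (seg x y ∩ V).Finite
  mem_edge : ∀ x, x ∉ V → ∃ u v, IsEdge V u v ∧ x ∈ seg u v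
  /-- distinct edges meet at most in vertices -/
  edge_unique : ∀ x, x ∉ V → ∀ u v u' v', IsEdge V u v → IsEdge V u' v' →
    x ∈ seg u v → x ∈ seg u' v' → seg u v = seg u' v'

/-! ### Free products and the outer space relative to a free factor system -/

/-- `G = H₁ * ⋯ * H_p * F` with `F` free of rank `k`. -/
def IsFreeProductDecomposition {G : Type*} [Group G] {p : ℕ} (H : Fin p → Subgroup G) (k : ℕ) :
    Prop :=
  ∃ b : Fin k → G, Function.Bijective
    (Monoid.Coprod.lift (Monoid.CoprodI.lift fun i => (H i).subtype) (FreeGroup.lift b))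

/-- `T`, with vertex set `V`, is a tree in the (unprojectivized) outer space of
`(G, {[H₁], …, [H_p]})`. -/
structure IsOuterSpaceTree {G : Type*} [Group G] {p : ℕ} (H : Fin p → Subgroup G)
    (T : Type*) [MetricSpace T] [MulAction G T] [IsIsometricSMul G T] (V : Set T) : Prop where
  simplicial : IsSimplicialTree T V
  smul_vertex : ∀ (g : G), ∀ v ∈ V, g • v ∈ V
  /-- no redundant vertices -/
  not_redundant : ∀ v ∈ V, ¬ ({w | IsEdge V v w}.ncard = 2 ∧
    ∀ g : G, g • v = v → ∀ w, IsEdge V v w → g • w = w)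
  /-- the action is non-trivial -/
  no_fixed_point : ∀ x : T, ∃ g : G, g • x ≠ x
  /-- the action is minimal: there is no proper invariant subtree -/
  minimal : ∀ S : Set T, S.Nonempty → (∀ x ∈ S, ∀ y ∈ S, seg x y ⊆ S) →
    (∀ g : G, ∀ x ∈ S, g • x ∈ S) → S = univ
  edge_stabilizer : ∀ u v, IsEdge V u v → ∀ g : G, g • u = u → g • v = v → g = 1
  finite_edge_orbits : ∃ S : Set (T × T), S.Finite ∧
    ∀ u v, IsEdge V u v → ∃ g : G, (g • u, g • v) ∈ S
  /-- each conjugate `g Hᵢ g⁻¹` fixes exactly one vertex -/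
  fixed_vertex : ∀ (i : Fin p) (g : G), ∃! v, v ∈ V ∧ ∀ h ∈ H i, (g * h * g⁻¹) • v = v
  /-- a vertex stabilizer is trivial or a conjugate of some `Hᵢ` -/
  vertex_stabilizer : ∀ v ∈ V, MulAction.stabilizer G v = ⊥ ∨
    ∃ (i : Fin p) (g : G), MulAction.stabilizer G v = (H i).map (MulAut.conj g).toMonoidHom

/-! ### Train track maps -/

/-- The turn at `v` formed by the edges `(v, a)` and `(v, b)` is legal for the gate structure
induced by `f`: the paths `f [v, a]` and `f [v, b]` have no common initial segment. -/
def LegalTurn {T : Type*} [MetricSpace T] (f : T → T) (v a b : T) : Prop :=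
  seg (f v) (f a) ∩ seg (f v) (f b) = {f v}

/-- `f : T → T` is a train track map representing `φ`, with stretch factor `lam` for the metric
of `T`. -/
structure IsTrainTrackMap {G : Type*} [Group G] {T : Type*} [MetricSpace T] [MulAction G T]
    (V : Set T) (φ : G →* G) (f : T → T) (lam : ℝ) : Prop where
  equivariant : ∀ (g : G) (x : T), f (g • x) = φ g • f x
  map_vertex : ∀ v ∈ V, f v ∈ V
  one_le : 1 ≤ lam
  /-- `f` maps each edge `e` injectively and linearly onto an edge path whose length is `lam`
  times the length of `e`. -/
  stretch : ∀ u v, IsEdge V u v → ∀ x ∈ seg u v, ∀ y ∈ seg u v,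
    dist (f x) (f y) = lam * dist x y
  /-- there are at least two gates at each vertex -/
  two_gates : ∀ v ∈ V, ∃ a b, IsEdge V v a ∧ IsEdge V v b ∧ LegalTurn f v a b
  /-- `f` sends edges to legal paths -/
  edge_legal : ∀ u v, IsEdge V u v → ∀ w a b, IsEdge V w a → IsEdge V w b → a ≠ b →
    a ∈ seg (f u) (f v) → b ∈ seg (f u) (f v) → LegalTurn f w a b
  /-- `f` sends legal turns to legal turns; the image turn consists of the first edges of the
  two image paths -/
  turn_legal : ∀ v a b, IsEdge V v a → IsEdge V v b → LegalTurn f v a b →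
    ∀ a' b', IsEdge V (f v) a' → IsEdge V (f v) b' →
      a' ∈ seg (f v) (f a) → b' ∈ seg (f v) (f b) → LegalTurn f (f v) a' b'

/-! ### The limiting tree -/

/-- `d_n(x, y) = d(fⁿ x, fⁿ y) / lamⁿ`. -/
noncomputable def scaledDist {T : Type*} [MetricSpace T] (f : T → T) (lam : ℝ) (n : ℕ)
    (x y : T) : ℝ :=
  dist (f^[n] x) (f^[n] y) / lam ^ n

/-- `d_n(x, y)` converges for all `x` and `y`. -/
def LimitsExist {T : Type*} [MetricSpace T] (f : T → T) (lam : ℝ) : Prop :=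
  ∀ x y : T, ∃ l : ℝ, Tendsto (fun n => scaledDist f lam n x y) atTop (𝓝 l)

/-- `d_∞(x, y) = lim d_n(x, y)`. -/
noncomputable def limDist {T : Type*} [MetricSpace T] (f : T → T) (lam : ℝ) (x y : T) : ℝ :=
  limUnder atTop (fun n => scaledDist f lam n x y)

section LimitTree

variable {G : Type*} [Group G] {T : Type*} [MetricSpace T] [MulAction G T] [IsIsometricSMul G T]
  {V : Set T} {φ : G →* G} {f : T → T} {lam : ℝ}

theorem LimitsExist.tendsto (hlim : LimitsExist f lam) (x y : T) :
    Tendsto (fun n => scaledDist f lam n x y) atTop (𝓝 (limDist f lam x y)) :=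
  tendsto_nhds_limUnder (hlim x y)

theorem IsTrainTrackMap.limDist_smul (hf : IsTrainTrackMap V φ f lam) (g : G) (x y : T) :
    limDist f lam (g • x) (g • y) = limDist f lam x y := by
  have key : ∀ (n : ℕ) (z : T), f^[n] (g • z) = (φ^[n] g) • f^[n] z := by
    intro n z
    induction n with
    | zero => rfl
    | succ n ih => rw [Function.iterate_succ_apply', Function.iterate_succ_apply',
        Function.iterate_succ_apply', ih, hf.equivariant]
  simp only [limDist, scaledDist, key, dist_smul]

/-- The set `T`, to be equipped with the pseudo-metric `d_∞` and with the action of `G`. -/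
def PreLimitTree (_hf : IsTrainTrackMap V φ f lam) (_hlim : LimitsExist f lam) : Type _ := T

noncomputable instance (hf : IsTrainTrackMap V φ f lam) (hlim : LimitsExist f lam) :
    PseudoMetricSpace (PreLimitTree hf hlim) where
  dist x y := limDist (T := T) f lam x y
  dist_self x := by
    refine tendsto_nhds_unique (hlim.tendsto (x : T) x) ?_
    simp [scaledDist]
  dist_comm x y := by
    refine tendsto_nhds_unique (hlim.tendsto (x : T) y) ?_
    have h := hlim.tendsto (y : T) x
    simpa only [scaledDist, dist_comm] using h
  dist_triangle x y z := by
    refine le_of_tendsto_of_tendsto' (hlim.tendsto (x : T) z)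
      ((hlim.tendsto (x : T) y).add (hlim.tendsto (y : T) z)) fun n => ?_
    have h0 : (0 : ℝ) ≤ lam ^ n := pow_nonneg (zero_le_one.trans hf.one_le) n
    simp only [scaledDist, ← add_div]
    exact div_le_div_of_nonneg_right (dist_triangle _ _ _) h0

instance (hf : IsTrainTrackMap V φ f lam) (hlim : LimitsExist f lam) :
    MulAction G (PreLimitTree hf hlim) :=
  inferInstanceAs (MulAction G T)

instance (hf : IsTrainTrackMap V φ f lam) (hlim : LimitsExist f lam) :
    IsIsometricSMul G (PreLimitTree hf hlim) where
  isometry_smul g := by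
    refine Isometry.of_dist_eq fun x y => ?_
    exact hf.limDist_smul g x y

/-- The limiting tree `T_∞`: the quotient of `(T, d_∞)` that identifies points at `d_∞`-distance
zero, with the induced metric and the induced action of `G`. -/
abbrev LimitTree (hf : IsTrainTrackMap V φ f lam) (hlim : LimitsExist f lam) : Type _ :=
  SeparationQuotient (PreLimitTree hf hlim)

instance (hf : IsTrainTrackMap V φ f lam) (hlim : LimitsExist f lam) :
    IsIsometricSMul G (LimitTree hf hlim) where
  isometry_smul g := by
    refine Isometry.of_dist_eq fun x y => ?_
    obtain ⟨x, rfl⟩ := SeparationQuotient.surjective_mk x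
    obtain ⟨y, rfl⟩ := SeparationQuotient.surjective_mk y
    rw [← SeparationQuotient.mk_smul, ← SeparationQuotient.mk_smul, SeparationQuotient.dist_mk,
      SeparationQuotient.dist_mk, dist_smul]

end LimitTree

/-! ### Arc stabilizers -/

/-- An arc: a subset homeomorphic to `[0, 1]`. -/
def IsArc {X : Type*} [TopologicalSpace X] (c : Set X) : Prop :=
  ∃ γ : unitInterval → X, Continuous γ ∧ Function.Injective γ ∧ range γ = c

/-- The (pointwise) stabilizer of every arc is trivial. -/
def HasTrivialArcStabilizers (G : Type*) [Group G] (X : Type*) [TopologicalSpace X]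
    [MulAction G X] : Prop :=
  ∀ c : Set X, IsArc c → fixingSubgroup G c = ⊥

/-! ### Segments in `ℝ`-trees -/

section RTree

variable {X : Type*} [MetricSpace X] {x y z w : X}

/-! Since `f` stretches each edge by `lam`, it is `lam`-Lipschitz (`dist_map_le`), so the scaled
distances `d_n` decrease and converge. The four-point inequality survives the limit. For geodesics,
`fⁿ [x, y]` covers the geodesic from `fⁿ x` to `fⁿ y`; a point dividing the latter in a given ratio
lifts to `[x, y]`, and by compactness the lifts accumulate at a point dividing `d_∞(x, y)` in that
ratio (`exists_limDist_eq`).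

Legality gives more: iterates of an edge stay legal, so `fⁿ` scales it by exactly `lamⁿ`
(`dist_iterate_eq`) and `T → T_∞` is isometric on edges.

Suppose `g` fixes an arc. The geodesic between its endpoints lifts to infinitely many points of one
segment of `T`, two of which, `x` and `y`, share an edge. For large `n` the element `φⁿ g` moves `fⁿ
x` and `fⁿ y` by little compared with `lamⁿ d(x, y)`, so it slides the middle of `fⁿ [x, y]` along
that path. As the edge embeds isometrically in `T_∞`, where `g` fixes its points, the slide is zero.
Thus `φⁿ g` fixes two points of `T` and is trivial, and so is `g` by injectivity of `φ`
(`eq_one_of_fixes_edge_points`). -/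

theorem mem_seg : z ∈ seg x y ↔ dist x z + dist z y = dist x y := Iff.rfl

theorem left_mem_seg (x y : X) : x ∈ seg x y := by simp [mem_seg]

theorem right_mem_seg (x y : X) : y ∈ seg x y := by simp [mem_seg]

theorem seg_symm (x y : X) : seg x y = seg y x := by
  ext z
  rw [mem_seg, mem_seg, dist_comm x z, dist_comm z y, dist_comm x y, add_comm]

theorem seg_self (x : X) : seg x x = {x} := by
  ext z
  rw [mem_seg, dist_self, dist_comm z x, mem_singleton_iff]
  constructor
  · intro h
    exact (dist_eq_zero.1 (by linarith)).symm
  · rintro rfl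
    simp

theorem seg_subset_left (hy : y ∈ seg x z) : seg x y ⊆ seg x z := by
  intro w hw
  rw [mem_seg] at *
  linarith [dist_triangle x w z, dist_triangle w y z]

theorem seg_subset_right (hy : y ∈ seg x z) : seg y z ⊆ seg x z := by
  rw [seg_symm y z, seg_symm x z]
  rw [seg_symm] at hy
  exact seg_subset_left hy

/-- If `y` is between `x` and `z`, and `w` between `y` and `z`, then `y` is between `x` and `w`. -/
theorem mem_seg_of_mem_right (hy : y ∈ seg x z) (hw : w ∈ seg y z) : y ∈ seg x w := by
  rw [mem_seg] at *
  linarith [dist_triangle x y w, dist_triangle x w z]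

theorem eq_of_mem_seg_of_mem_seg (hy : y ∈ seg x z) (hx : x ∈ seg y z) : x = y := by
  rw [mem_seg] at *
  rw [dist_comm y x] at hx
  exact dist_eq_zero.1 (by linarith)

theorem smul_mem_seg {G : Type*} [Group G] [MulAction G X] [IsIsometricSMul G X] (g : G)
    (hz : z ∈ seg x y) : g • z ∈ seg (g • x) (g • y) := by
  simpa [mem_seg, dist_smul] using hz

namespace IsRTree

variable (hX : IsRTree X)
include hX

/-- In the four-point inequality for `x, y, z, w`, the two terms of the maximum are `dist x y ±
(dist x z - dist x w)`. -/
theorem dist_le_of_mem_seg (hz : z ∈ seg x y) (hw : w ∈ seg x y) :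
    dist z w ≤ |dist x z - dist x w| := by
  have h := hX.four_point x y z w
  rw [mem_seg] at hz hw
  have h1 := le_abs_self (dist x z - dist x w)
  have h2 := neg_abs_le (dist x z - dist x w)
  rw [dist_comm y w, dist_comm y z] at h
  rcases le_max_iff.1 h with h | h <;> linarith

theorem eq_of_mem_seg (hz : z ∈ seg x y) (hw : w ∈ seg x y) (h : dist x z = dist x w) :
    z = w := by
  have := hX.dist_le_of_mem_seg hz hw
  rw [h, sub_self, abs_zero] at this
  exact dist_le_zero.1 this

theorem exists_mem_seg (x y : X) {t : ℝ} (h0 : 0 ≤ t) (h1 : t ≤ dist x y) :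
    ∃ z ∈ seg x y, dist x z = t := by
  obtain ⟨γ, hγ0, hγ1, hγ⟩ := hX.geodesic x y
  have a := hγ 0 ⟨le_rfl, dist_nonneg⟩ t ⟨h0, h1⟩
  have b := hγ t ⟨h0, h1⟩ (dist x y) ⟨dist_nonneg, le_rfl⟩
  rw [hγ0, zero_sub, abs_neg, abs_of_nonneg h0] at a
  rw [hγ1, abs_sub_comm, abs_of_nonneg (by linarith)] at b
  exact ⟨γ t, by rw [mem_seg]; linarith, a⟩

theorem isCompact_seg (x y : X) : IsCompact (seg x y) := by
  obtain ⟨γ, hγ0, hγ1, hγ⟩ := hX.geodesic x y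
  have hc : ContinuousOn γ (Icc 0 (dist x y)) := by
    have : LipschitzOnWith 1 γ (Icc 0 (dist x y)) :=
      LipschitzOnWith.of_dist_le_mul fun s hs t ht => by
        rw [hγ s hs t ht, Real.dist_eq]; simp
    exact this.continuousOn
  have hmem : ∀ t ∈ Icc 0 (dist x y), γ t ∈ seg x y ∧ dist x (γ t) = t := by
    intro t ht
    have a := hγ 0 ⟨le_rfl, dist_nonneg⟩ t ht
    have b := hγ t ht (dist x y) ⟨dist_nonneg, le_rfl⟩
    rw [hγ0, zero_sub, abs_neg, abs_of_nonneg ht.1] at a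
    rw [hγ1, abs_sub_comm, abs_of_nonneg (by linarith [ht.2])] at b
    exact ⟨by rw [mem_seg]; linarith, a⟩
  have : seg x y = γ '' Icc 0 (dist x y) := by
    ext z
    constructor
    · intro hz
      have hz' := hz
      rw [mem_seg] at hz'
      have ht : dist x z ∈ Icc 0 (dist x y) :=
        ⟨dist_nonneg, by linarith [dist_nonneg (x := z) (y := y)]⟩
      exact ⟨_, ht, hX.eq_of_mem_seg (hmem _ ht).1 hz (hmem _ ht).2⟩
    · rintro ⟨t, ht, rfl⟩
      exact (hmem t ht).1
  rw [this]
  exact isCompact_Icc.image_of_continuousOn hc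

/-- Triangles are tripods: each side is covered by the two others. -/
theorem mem_seg_or (y : X) (hw : w ∈ seg x z) : w ∈ seg x y ∨ w ∈ seg y z := by
  have h := hX.four_point x z w y
  rw [mem_seg] at hw
  rw [mem_seg, mem_seg]
  rw [dist_comm z y, dist_comm z w] at h
  have h1 := dist_triangle y w z
  have h2 := dist_triangle x w y
  rw [dist_comm y w] at *
  rcases le_max_iff.1 h with h | h
  · right; linarith
  · left; linarith

theorem exists_median (x y z : X) : ∃ c, c ∈ seg x y ∧ c ∈ seg x z ∧ c ∈ seg y z := by
  have h1 := dist_triangle x y z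
  have h2 := dist_triangle x z y
  have h3 := dist_triangle y x z
  rw [dist_comm z y] at h2
  rw [dist_comm y x] at h3
  -- The distance from `x` to the branch point is the Gromov product of `y` and `z`. With this
  -- choice both terms of the maximum below equal half the perimeter.
  obtain ⟨c, hc, hxc⟩ := hX.exists_mem_seg x y
    (t := (dist x y + dist x z - dist y z) / 2) (by linarith) (by linarith)
  have h := hX.four_point x y c z
  rw [mem_seg] at hc
  have h4 := dist_triangle x c z
  have h5 := dist_triangle y c z
  rw [dist_comm y c] at h h5
  refine ⟨c, hc, ?_, ?_⟩ <;> rw [mem_seg]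
  · rcases le_max_iff.1 h with h | h <;> linarith
  · rw [dist_comm y c]
    rcases le_max_iff.1 h with h | h <;> linarith

/-- The median of the triangle lies on both sides issuing from `y`, so it is `y`. -/
theorem mem_seg_of_inter_eq (h : seg y x ∩ seg y z = {y}) : y ∈ seg x z := by
  obtain ⟨c, h1, h2, h3⟩ := hX.exists_median x y z
  have : c ∈ seg y x ∩ seg y z := ⟨seg_symm x y ▸ h1, h3⟩
  rw [h, mem_singleton_iff] at this
  exact this ▸ h2

/-- A point of `seg x y` far enough from the endpoints lies on `seg x' y'` when `x'` is close to
`x` and `y'` is close to `y`. -/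
theorem mem_seg_of_dist_lt {x' y' : X} (hz : z ∈ seg x y) (hx : dist x x' < dist x z)
    (hy : dist y y' < dist z y) : z ∈ seg x' y' := by
  have h1 : z ∈ seg x' y := by
    refine (hX.mem_seg_or x' hz).resolve_left fun h => ?_
    rw [mem_seg] at h
    linarith [dist_nonneg (x := z) (y := x')]
  refine (hX.mem_seg_or y' h1).resolve_right fun h => ?_
  rw [mem_seg] at h
  rw [dist_comm y' y] at h
  linarith [dist_nonneg (x := y') (y := z)]

omit hX in
/-- A `0`-hyperbolic space in which every distance between `0` and `dist x y` is realized by a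
point of `seg x y` is an `ℝ`-tree. -/
theorem of_exists_mem_seg (hne : Nonempty X)
    (hseg : ∀ x y : X, ∀ t ∈ Icc 0 (dist x y), ∃ z ∈ seg x y, dist x z = t)
    (h4 : ∀ x y z w : X,
      dist x y + dist z w ≤ max (dist x z + dist y w) (dist x w + dist y z)) : IsRTree X := by
  refine ⟨hne, fun x y => ?_, h4⟩
  have hseg' : ∀ t : ℝ, ∃ z, t ∈ Icc 0 (dist x y) → z ∈ seg x y ∧ dist x z = t := by
    intro t
    by_cases ht : t ∈ Icc 0 (dist x y)
    · obtain ⟨z, hz⟩ := hseg x y t ht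
      exact ⟨z, fun _ => hz⟩
    · exact ⟨x, fun h => absurd h ht⟩
  choose γ hγ using hseg'
  refine ⟨γ, ?_, ?_, fun s hs t ht => ?_⟩
  · exact (dist_eq_zero.1 (hγ 0 ⟨le_rfl, dist_nonneg⟩).2).symm
  · obtain ⟨h1, h2⟩ := hγ _ ⟨dist_nonneg, le_rfl⟩
    rw [mem_seg] at h1
    exact dist_eq_zero.1 (by linarith)
  · obtain ⟨hs1, hs2⟩ := hγ s hs
    obtain ⟨ht1, ht2⟩ := hγ t ht
    have h := h4 x y (γ s) (γ t)
    rw [mem_seg] at hs1 ht1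
    rw [dist_comm y (γ t), dist_comm y (γ s)] at h
    apply le_antisymm
    · have h1 := le_abs_self (s - t)
      have h2 := neg_abs_le (s - t)
      rcases le_max_iff.1 h with h | h <;> linarith
    · rw [abs_le]
      have h1 := dist_triangle x (γ s) (γ t)
      have h2 := dist_triangle x (γ t) (γ s)
      rw [dist_comm (γ t)] at h2
      constructor <;> linarith

end IsRTree

end RTree

/-! ### Simplicial trees -/

section Simplicial

variable {T : Type*} [MetricSpace T] {V : Set T}

theorem IsEdge.left_mem {u v : T} (h : IsEdge V u v) : u ∈ V :=
  (h.2.symm ▸ mem_insert u {v} : u ∈ seg u v ∩ V).2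

theorem IsEdge.symm {u v : T} (h : IsEdge V u v) : IsEdge V v u :=
  ⟨h.1.symm, by rw [seg_symm, h.2, pair_comm]⟩

theorem IsEdge.right_mem {u v : T} (h : IsEdge V u v) : v ∈ V := h.symm.left_mem

theorem IsEdge.eq_or_eq {u v w : T} (h : IsEdge V u v) (hw : w ∈ V) (hs : w ∈ seg u v) :
    w = u ∨ w = v := by
  have : w ∈ seg u v ∩ V := ⟨hs, hw⟩
  simpa [h.2] using this

theorem isEdge_of_forall {u v : T} (hu : u ∈ V) (hv : v ∈ V) (hne : u ≠ v)
    (h : ∀ w ∈ seg u v, w ∈ V → w = u ∨ w = v) : IsEdge V u v := by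
  refine ⟨hne, Subset.antisymm (fun w hw => h w hw.1 hw.2) ?_⟩
  rintro w (rfl | rfl)
  · exact ⟨left_mem_seg _ _, hu⟩
  · exact ⟨right_mem_seg _ _, hv⟩

namespace IsSimplicialTree

variable (hT : IsSimplicialTree T V)
include hT

/-- The vertex of `seg x w` closest to `x` and different from `x`. -/
theorem exists_first_vertex {x w : T} (hw : w ∈ V) (hxw : x ≠ w) :
    ∃ v ∈ V, v ∈ seg x w ∧ v ≠ x ∧ ∀ a ∈ seg x v, a ∈ V → a = x ∨ a = v := by
  have hfin : ((seg x w ∩ V) \ {x}).Finite := (hT.finite_vertices x w).subset sdiff_subset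
  obtain ⟨v, ⟨⟨hvs, hvV⟩, hvx⟩, hmin⟩ := exists_min_image _ (dist x) hfin
    ⟨w, ⟨right_mem_seg _ _, hw⟩, fun h => hxw h.symm⟩
  refine ⟨v, hvV, hvs, hvx, fun a ha haV => ?_⟩
  by_contra! hcon
  have h1 := hmin a ⟨⟨seg_subset_left hvs ha, haV⟩, hcon.1⟩
  rw [mem_seg] at ha
  exact hcon.2 (dist_le_zero.1 (by linarith))

/-- An edge around `y` has an endpoint `u` with `y` between `u` and `x`. A vertex strictly inside
`seg u x` would lie either before `y`, inside that edge, or after `y`, against the hypothesis. -/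
theorem exists_edge_of_vertex {x y : T} (hx : x ∈ V) (hy : y ∉ V)
    (h : ∀ a ∈ seg x y, a ∈ V → a = x) : ∃ u, IsEdge V u x ∧ y ∈ seg u x := by
  obtain ⟨u, v, he, hm⟩ := hT.mem_edge y hy
  have key : ∀ u v, IsEdge V u v → y ∈ seg u v → y ∈ seg u x →
      ∃ u, IsEdge V u x ∧ y ∈ seg u x := by
    intro u v he hm hu
    refine ⟨u, isEdge_of_forall he.left_mem hx ?_ fun w hw hwV => ?_, hu⟩
    · rintro rfl
      rw [seg_self] at hu
      exact hy (mem_singleton_iff.1 hu ▸ hx)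
    · rcases hT.isRTree.mem_seg_or y hw with hw' | hw'
      · rcases he.eq_or_eq hwV (seg_subset_left hm hw') with h' | h'
        · exact Or.inl h'
        · subst h'
          have := eq_of_mem_seg_of_mem_seg (seg_symm u w ▸ hm) (seg_symm u y ▸ hw')
          exact absurd (this ▸ hwV) hy
      · exact Or.inr (h w (seg_symm y x ▸ hw') hwV)
  rcases hT.isRTree.mem_seg_or x hm with hu | hv
  · exact key u v he hm hu
  · exact key v u he.symm (seg_symm u v ▸ hm) (seg_symm x v ▸ hv)

theorem exists_edge {x y : T} (hxy : x ≠ y) (h : ∀ a ∈ seg x y, a ∈ V → a = x ∨ a = y) :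
    ∃ u v, IsEdge V u v ∧ x ∈ seg u v ∧ y ∈ seg u v := by
  by_cases hx : x ∈ V
  · by_cases hy : y ∈ V
    · exact ⟨x, y, isEdge_of_forall hx hy hxy h, left_mem_seg _ _, right_mem_seg _ _⟩
    · obtain ⟨u, he, hu⟩ := hT.exists_edge_of_vertex hx hy fun a ha haV =>
        (h a ha haV).resolve_right fun e => hy (e ▸ haV)
      exact ⟨u, x, he, right_mem_seg _ _, hu⟩
  · by_cases hy : y ∈ V
    · obtain ⟨u, he, hu⟩ := hT.exists_edge_of_vertex hy hx fun a ha haV =>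
        (h a (seg_symm y x ▸ ha) haV).resolve_left fun e => hx (e ▸ haV)
      exact ⟨u, y, he, hu, right_mem_seg _ _⟩
    -- Neither point is a vertex: prolong `seg x y` beyond `y` to a vertex `w`. The first vertex
    -- after `x` on `seg x w` then comes after `y`, which reduces to the previous lemma.
    · have hw : ∃ w ∈ V, y ∈ seg x w := by
        obtain ⟨u, v, he, hm⟩ := hT.mem_edge y hy
        rcases hT.isRTree.mem_seg_or x hm with hu | hv
        · exact ⟨u, he.left_mem, seg_symm u x ▸ hu⟩
        · exact ⟨v, he.right_mem, hv⟩
      obtain ⟨w, hwV, hyw⟩ := hw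
      obtain ⟨v, hvV, hvs, hvx, hv⟩ := hT.exists_first_vertex hwV fun e : x = w => hx (e ▸ hwV)
      have hyv : y ∈ seg x v := by
        refine (hT.isRTree.mem_seg_or v hyw).resolve_right fun hc => ?_
        rcases h v (mem_seg_of_mem_right hvs hc) hvV with e | e
        · exact hvx e
        · exact hy (e ▸ hvV)
      obtain ⟨u, he, hu⟩ := hT.exists_edge_of_vertex hvV hx fun a ha haV =>
        (hv a (seg_symm v x ▸ ha) haV).resolve_left fun e => hx (e ▸ haV)
      exact ⟨u, v, he, hu, seg_subset_right hu hyv⟩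

/-- Induction over segments: a property of pairs of points holds if it holds for pairs in a common
edge and is stable under concatenation of segments. -/
theorem seg_induction {P : T → T → Prop} (refl : ∀ x, P x x)
    (edge : ∀ u v x y, IsEdge V u v → x ∈ seg u v → y ∈ seg u v → P x y)
    (trans : ∀ x y z, y ∈ seg x z → P x y → P y z → P x z) (x y : T) : P x y := by
  -- The induction is on the number of vertices strictly between `x` and `y`; cutting at one of them
  -- removes it from the count of both halves.
  induction hn : ((seg x y ∩ V) \ {x, y}).ncard using Nat.strong_induction_on generalizing x y with
  | _ n ih =>
    by_cases hxy : x = y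
    · exact hxy ▸ refl x
    by_cases h : ∀ a ∈ seg x y, a ∈ V → a = x ∨ a = y
    · obtain ⟨u, v, he, hx, hy⟩ := hT.exists_edge hxy h
      exact edge u v x y he hx hy
    · push Not at h
      obtain ⟨a, ha, haV, hax, hay⟩ := h
      have hfin : ((seg x y ∩ V) \ {x, y}).Finite :=
        (hT.finite_vertices x y).subset sdiff_subset
      refine trans x a y ha (ih _ ?_ x a rfl) (ih _ ?_ a y rfl)
      · rw [← hn]
        refine ncard_lt_ncard (ssubset_iff_of_subset ?_ |>.2 ⟨a, ⟨⟨ha, haV⟩, by simp [hax, hay]⟩,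
          by simp⟩) hfin
        rintro b ⟨⟨hb, hbV⟩, hb'⟩
        simp only [mem_insert_iff, mem_singleton_iff, not_or] at hb'
        refine ⟨⟨seg_subset_left ha hb, hbV⟩, ?_⟩
        simp only [mem_insert_iff, mem_singleton_iff, not_or]
        refine ⟨hb'.1, ?_⟩
        rintro rfl
        exact hay (eq_of_mem_seg_of_mem_seg (seg_symm x b ▸ ha) (seg_symm x a ▸ hb)).symm
      · rw [← hn]
        refine ncard_lt_ncard (ssubset_iff_of_subset ?_ |>.2 ⟨a, ⟨⟨ha, haV⟩, by simp [hax, hay]⟩,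
          by simp⟩) hfin
        rintro b ⟨⟨hb, hbV⟩, hb'⟩
        simp only [mem_insert_iff, mem_singleton_iff, not_or] at hb'
        refine ⟨⟨seg_subset_right ha hb, hbV⟩, ?_⟩
        simp only [mem_insert_iff, mem_singleton_iff, not_or]
        refine ⟨?_, hb'.2⟩
        rintro rfl
        exact hax (eq_of_mem_seg_of_mem_seg ha hb).symm

/-- An infinite subset of a segment has two distinct points in a common edge. -/
theorem exists_edge_of_infinite {x y : T} {Z : Set T} (hZ : Z.Infinite) (hsub : Z ⊆ seg x y) :
    ∃ u v, IsEdge V u v ∧ ∃ a ∈ Z, ∃ b ∈ Z, a ≠ b ∧ a ∈ seg u v ∧ b ∈ seg u v := by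
  revert Z
  refine hT.seg_induction (P := fun x y => ∀ {Z : Set T}, Z.Infinite → Z ⊆ seg x y →
    ∃ u v, IsEdge V u v ∧ ∃ a ∈ Z, ∃ b ∈ Z, a ≠ b ∧ a ∈ seg u v ∧ b ∈ seg u v) ?_ ?_ ?_ x y
  · intro x Z hZ hsub
    rw [seg_self] at hsub
    exact absurd ((finite_singleton x).subset hsub) hZ
  · intro u v x y he hx hy Z hZ hsub
    obtain ⟨a, ha, b, hb, hab⟩ := hZ.nontrivial
    have hs : seg x y ⊆ seg u v := by
      intro w hw
      rcases hT.isRTree.mem_seg_or u hw with h | h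
      · exact seg_subset_left hx (seg_symm x u ▸ h)
      · exact seg_subset_left hy h
    exact ⟨u, v, he, a, ha, b, hb, hab, hs (hsub ha), hs (hsub hb)⟩
  · intro x y z hy h1 h2 Z hZ hsub
    have hcov : Z = (Z ∩ seg x y) ∪ (Z ∩ seg y z) := by
      rw [← inter_union_distrib_left]
      exact (inter_eq_left.2 fun w hw => hT.isRTree.mem_seg_or y (hsub hw)).symm
    rw [hcov, infinite_union] at hZ
    rcases hZ with hZ | hZ
    · obtain ⟨u, v, he, a, ha, b, hb, h⟩ := h1 hZ inter_subset_right
      exact ⟨u, v, he, a, ha.1, b, hb.1, h⟩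
    · obtain ⟨u, v, he, a, ha, b, hb, h⟩ := h2 hZ inter_subset_right
      exact ⟨u, v, he, a, ha.1, b, hb.1, h⟩

/-- Distinct edges issuing from a vertex `w` leave it in different directions. -/
theorem mem_seg_of_edges {w a b : T} (ha : IsEdge V w a) (hb : IsEdge V w b) (hab : a ≠ b) :
    w ∈ seg a b := by
  obtain ⟨c, h1, h2, h3⟩ := hT.isRTree.exists_median w a b
  by_cases hc : c ∈ V
  · rcases ha.eq_or_eq hc h1 with e | e
    · exact e ▸ h3
    · rcases hb.eq_or_eq hc h2 with e' | e'
      · exact e' ▸ h3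
      · exact absurd (e.symm.trans e') hab
  · have h := hT.edge_unique c hc w a w b ha hb h1 h2
    have hb' : b ∈ seg w a := h ▸ right_mem_seg w b
    rcases ha.eq_or_eq hb.right_mem hb' with e | e
    · exact absurd e.symm hb.1
    · exact absurd e.symm hab

end IsSimplicialTree

end Simplicial

/-! ### Train track maps -/

section TrainTrack

variable {G : Type*} [Group G] {T : Type*} [MetricSpace T] [MulAction G T]
  {V : Set T} {φ : G →* G} {f : T → T} {lam : ℝ}

/-- All turns crossed by the segment `seg u v` are legal. -/
def LegalSeg (V : Set T) (f : T → T) (u v : T) : Prop :=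
  ∀ w a b, IsEdge V w a → IsEdge V w b → a ≠ b → a ∈ seg u v → b ∈ seg u v → LegalTurn f w a b

/-- If the Lipschitz bound is attained at the endpoints, no length can be lost in between. -/
theorem mem_seg_of_scaling {x y z : T} (hle : ∀ x y, dist (f x) (f y) ≤ lam * dist x y)
    (h : dist (f x) (f y) = lam * dist x y) (hz : z ∈ seg x y) : f z ∈ seg (f x) (f y) := by
  rw [mem_seg] at *
  have h1 := hle x z
  have h2 := hle z y
  rw [← hz, mul_add] at h
  linarith [dist_triangle (f x) (f z) (f y)]

theorem dist_eq_of_scaling (hX : IsRTree T) {x y z w : T}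
    (hle : ∀ x y, dist (f x) (f y) ≤ lam * dist x y)
    (h : dist (f x) (f y) = lam * dist x y) (hz : z ∈ seg x y) (hw : w ∈ seg x y) :
    dist (f z) (f w) = lam * dist z w := by
  have hsub : ∀ {a b c : T}, dist (f a) (f b) = lam * dist a b → c ∈ seg a b →
      dist (f a) (f c) = lam * dist a c := by
    intro a b c h hc
    have := mem_seg_of_scaling hle h hc
    rw [mem_seg] at this hc
    have h1 := hle a c
    have h2 := hle c b
    rw [← hc, mul_add] at h
    linarith
  rcases hX.mem_seg_or z hw with hw' | hw'
  · have := hsub (by rw [dist_comm, hsub h hz, dist_comm]) (seg_symm x z ▸ hw')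
    exact this
  · have h1 : dist (f z) (f y) = lam * dist z y := by
      rw [dist_comm, dist_comm z y]
      exact hsub (by rw [dist_comm, h, dist_comm]) (seg_symm x y ▸ hz)
    exact hsub h1 hw'

namespace IsTrainTrackMap

theorem lam_pos (hf : IsTrainTrackMap V φ f lam) : 0 < lam := zero_lt_one.trans_le hf.one_le

theorem iterate_smul (hf : IsTrainTrackMap V φ f lam) (g : G) (n : ℕ) (x : T) :
    f^[n] (g • x) = (φ^[n] g) • f^[n] x := by
  induction n with
  | zero => rfl
  | succ n ih => rw [Function.iterate_succ_apply', Function.iterate_succ_apply',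
      Function.iterate_succ_apply', ih, hf.equivariant]

/-- Only an inequality survives concatenation of edges, since `f` may fold at the vertices. -/
theorem dist_map_le (hf : IsTrainTrackMap V φ f lam) (hT : IsSimplicialTree T V) (x y : T) :
    dist (f x) (f y) ≤ lam * dist x y := by
  refine hT.seg_induction (P := fun x y => dist (f x) (f y) ≤ lam * dist x y) ?_ ?_ ?_ x y
  · intro x
    simp
  · intro u v x y he hx hy
    exact (hf.stretch u v he x hx y hy).le
  · intro x y z hy h1 h2
    rw [mem_seg] at hy
    rw [← hy, mul_add]
    exact (dist_triangle _ _ _).trans (add_le_add h1 h2)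

theorem dist_iterate_le (hf : IsTrainTrackMap V φ f lam) (hT : IsSimplicialTree T V) (n : ℕ)
    (x y : T) : dist (f^[n] x) (f^[n] y) ≤ lam ^ n * dist x y := by
  induction n with
  | zero => simp
  | succ n ih =>
    rw [Function.iterate_succ_apply', Function.iterate_succ_apply', pow_succ', mul_assoc]
    exact (hf.dist_map_le hT _ _).trans (mul_le_mul_of_nonneg_left ih hf.lam_pos.le)

/-- An intermediate value property: a path in a tree covers the geodesic between its endpoints.
Tripods let the preimage be sought in one piece of the segment at a time. -/
theorem exists_of_mem_seg_map (hf : IsTrainTrackMap V φ f lam) (hT : IsSimplicialTree T V)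
    {x y r : T} (hr : r ∈ seg (f x) (f y)) : ∃ z ∈ seg x y, f z = r := by
  revert r
  refine hT.seg_induction (P := fun x y => ∀ {r : T}, r ∈ seg (f x) (f y) →
    ∃ z ∈ seg x y, f z = r) ?_ ?_ ?_ x y
  · intro x r hr
    rw [seg_self] at hr
    exact ⟨x, left_mem_seg _ _, (mem_singleton_iff.1 hr).symm⟩
  · intro u v x y he hx hy r hr
    have hxy := hf.stretch u v he x hx y hy
    have hr' := hr
    rw [mem_seg, hxy] at hr'
    obtain ⟨z, hz, hxz⟩ := hT.isRTree.exists_mem_seg x y (t := dist (f x) r / lam)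
      (div_nonneg dist_nonneg hf.lam_pos.le)
      (by rw [div_le_iff₀' hf.lam_pos]; linarith [dist_nonneg (x := r) (y := f y)])
    refine ⟨z, hz, hT.isRTree.eq_of_mem_seg
      (mem_seg_of_scaling (hf.dist_map_le hT) hxy hz) hr ?_⟩
    rw [dist_eq_of_scaling hT.isRTree (hf.dist_map_le hT) hxy (left_mem_seg _ _) hz, hxz]
    exact mul_div_cancel₀ _ hf.lam_pos.ne'
  · intro x y z hy h1 h2 r hr
    rcases hT.isRTree.mem_seg_or (f y) hr with h | h
    · obtain ⟨w, hw, e⟩ := h1 h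
      exact ⟨w, seg_subset_left hy hw, e⟩
    · obtain ⟨w, hw, e⟩ := h2 h
      exact ⟨w, seg_subset_right hy hw, e⟩

theorem exists_of_mem_seg_iterate (hf : IsTrainTrackMap V φ f lam) (hT : IsSimplicialTree T V)
    (n : ℕ) {x y r : T} (hr : r ∈ seg (f^[n] x) (f^[n] y)) : ∃ z ∈ seg x y, f^[n] z = r := by
  induction n generalizing r with
  | zero => exact ⟨r, hr, rfl⟩
  | succ n ih =>
    rw [Function.iterate_succ_apply', Function.iterate_succ_apply'] at hr
    obtain ⟨s, hs, rfl⟩ := hf.exists_of_mem_seg_map hT hr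
    obtain ⟨z, hz, rfl⟩ := ih hs
    exact ⟨z, hz, Function.iterate_succ_apply' _ _ _⟩

/-- If the turn at `o` between the edges to `a` and `b` is legal and the image of `seg o b` is an
initial part of `seg (f o) (f c)`, then `f o` lies between `f a` and `f c`. -/
theorem map_mem_seg_of_legalTurn (hT : IsSimplicialTree T V) {o a b c : T}
    (hl : LegalTurn f o a b) (hb : f b ∈ seg (f o) (f c)) (hne : f b ≠ f o) :
    f o ∈ seg (f a) (f c) := by
  refine hT.isRTree.mem_seg_of_inter_eq (Subset.antisymm ?_ ?_)
  · rintro r ⟨hra, hrc⟩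
    rcases hT.isRTree.mem_seg_or (f b) hrc with h | h
    · have : r ∈ seg (f o) (f a) ∩ seg (f o) (f b) := ⟨hra, h⟩
      rwa [hl] at this
    · have h1 : f b ∈ seg (f o) r := mem_seg_of_mem_right hb h
      have : f b ∈ seg (f o) (f a) ∩ seg (f o) (f b) :=
        ⟨seg_subset_left hra h1, right_mem_seg _ _⟩
      rw [hl] at this
      exact absurd this hne
  · rintro _ rfl
    exact ⟨left_mem_seg _ _, left_mem_seg _ _⟩

/-- A turn involves three distinct vertices, and an edge contains only two. -/
theorem legalSeg_of_isEdge (hT : IsSimplicialTree T V) {u v : T} (he : IsEdge V u v) :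
    LegalSeg V f u v := by
  intro w a b ha hb hab hau hbu
  have hw := hT.mem_seg_of_edges ha hb hab
  have hwu : w ∈ seg u v := by
    rcases hT.isRTree.mem_seg_or u hw with h | h
    · exact seg_subset_left hau (seg_symm a u ▸ h)
    · exact seg_subset_left hbu h
  have h1 := ha.1
  have h2 := hb.1
  rcases he.eq_or_eq ha.right_mem hau with rfl | rfl <;>
  rcases he.eq_or_eq hb.right_mem hbu with rfl | rfl <;>
  rcases he.eq_or_eq ha.left_mem hwu with rfl | rfl <;> contradiction

/-- A train track map stretches legal segments by `lam` and sends them to legal segments. -/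
theorem dist_map_and_legalSeg_map (hf : IsTrainTrackMap V φ f lam) (hT : IsSimplicialTree T V)
    {u v : T} (hu : u ∈ V) (hv : v ∈ V) (hl : LegalSeg V f u v) :
    dist (f u) (f v) = lam * dist u v ∧ LegalSeg V f (f u) (f v) := by
  induction hn : (seg u v ∩ V).ncard using Nat.strong_induction_on generalizing u with
  | _ n ih =>
    by_cases huv : u = v
    · subst huv
      refine ⟨by simp, fun w a b _ _ hab ha hb => ?_⟩
      rw [seg_self] at ha hb
      exact absurd (ha.trans hb.symm) hab
    obtain ⟨o, hoV, hos, hou, ho⟩ := hT.exists_first_vertex hv huv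
    have heo : IsEdge V u o := isEdge_of_forall hu hoV hou.symm ho
    by_cases hov : o = v
    · subst hov
      exact ⟨hf.stretch u o heo u (left_mem_seg _ _) o (right_mem_seg _ _),
        hf.edge_legal u o heo⟩
    have hunot : u ∉ seg o v := fun h => hou (eq_of_mem_seg_of_mem_seg hos h).symm
    obtain ⟨hd, hl'⟩ := ih _ (by
      rw [← hn]
      refine ncard_lt_ncard (ssubset_iff_of_subset ?_ |>.2 ⟨u, ⟨left_mem_seg _ _, hu⟩,
        fun h => hunot h.1⟩) (hT.finite_vertices u v)
      exact inter_subset_inter_left _ (seg_subset_right hos)) hoV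
      (fun w a b ha hb hab hau hbu => hl w a b ha hb hab (seg_subset_right hos hau)
        (seg_subset_right hos hbu)) rfl
    -- After the first edge `[u, o]` is peeled off, `q` is the next vertex; legality of the turn at
    -- `o` prevents cancellation between the images of `[u, o]` and `[o, v]`.
    obtain ⟨q, hqV, hqs, hqo, hq⟩ := hT.exists_first_vertex hv hov
    have heq : IsEdge V o q := isEdge_of_forall hoV hqV hqo.symm hq
    have huq : u ≠ q := fun e => hunot (e ▸ hqs)
    have hturn : LegalTurn f o u q := hl o u q heo.symm heq huq (left_mem_seg _ _)
      (seg_subset_right hos hqs)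
    have hfq : f q ∈ seg (f o) (f v) := mem_seg_of_scaling (hf.dist_map_le hT) hd hqs
    have hfqo : f q ≠ f o := by
      rw [← dist_pos, hf.stretch o q heq q (right_mem_seg _ _) o (left_mem_seg _ _)]
      exact mul_pos hf.lam_pos (dist_pos.2 hqo)
    have hfo : f o ∈ seg (f u) (f v) := map_mem_seg_of_legalTurn hT hturn hfq hfqo
    refine ⟨?_, ?_⟩
    · rw [← mem_seg.1 hfo, hd, hf.stretch u o heo u (left_mem_seg _ _) o (right_mem_seg _ _),
        ← mul_add, mem_seg.1 hos]
    -- A turn of the image path contained in neither piece is based at `f o` and consists of first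
    -- edges of `f [o, u]` and `f [o, q]`, so `turn_legal` covers it.
    · have hmixed : ∀ w a b, IsEdge V w a → IsEdge V w b → a ≠ b → a ∈ seg (f u) (f o) →
          a ∉ seg (f o) (f v) → b ∉ seg (f u) (f o) → b ∈ seg (f o) (f v) →
          w = f o ∧ b ∈ seg (f o) (f q) := by
        intro w a b ha hb hab ha1 ha2 hb1 hb2
        have hw := hT.mem_seg_of_edges ha hb hab
        have hfoV := hf.map_vertex o hoV
        have hoab : f o ∈ seg a b := by
          have h1 : f o ∈ seg a (f v) := by
            rw [seg_symm] at hfo ha1 ⊢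
            exact mem_seg_of_mem_right hfo (seg_symm (f u) (f o) ▸ ha1)
          exact mem_seg_of_mem_right h1 hb2
        have hwo : f o = w := by
          rcases hT.isRTree.mem_seg_or w hoab with h | h
          · rcases ha.eq_or_eq hfoV (seg_symm a w ▸ h) with e | e
            · exact e
            · exact absurd (e ▸ left_mem_seg _ _) ha2
          · rcases hb.eq_or_eq hfoV h with e | e
            · exact e
            · exact absurd (e ▸ right_mem_seg _ _) hb1
        refine ⟨hwo.symm, ?_⟩
        rcases hT.isRTree.mem_seg_or (f q) hb2 with h | h
        · exact h
        · have h' : f q ∈ seg w b := hwo ▸ mem_seg_of_mem_right hfq h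
          rcases hb.eq_or_eq (hf.map_vertex q hqV) h' with e | e
          · exact absurd (e.trans hwo.symm) hfqo
          · exact e ▸ right_mem_seg _ _
      intro w a b ha hb hab hau hbu
      by_cases hao : a ∈ seg (f u) (f o)
      · by_cases hbo : b ∈ seg (f u) (f o)
        · exact hf.edge_legal u o heo w a b ha hb hab hao hbo
        · have hbo' := (hT.isRTree.mem_seg_or (f o) hbu).resolve_left hbo
          by_cases hao' : a ∈ seg (f o) (f v)
          · exact hl' w a b ha hb hab hao' hbo'
          · obtain ⟨rfl, hbq⟩ := hmixed w a b ha hb hab hao hao' hbo hbo'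
            exact hf.turn_legal o u q heo.symm heq hturn a b ha hb
              (seg_symm (f u) (f o) ▸ hao) hbq
      · have hao' := (hT.isRTree.mem_seg_or (f o) hau).resolve_left hao
        by_cases hbo' : b ∈ seg (f o) (f v)
        · exact hl' w a b ha hb hab hao' hbo'
        · have hbo := (hT.isRTree.mem_seg_or (f o) hbu).resolve_right hbo'
          obtain ⟨rfl, haq⟩ := hmixed w b a hb ha hab.symm hbo hbo' hao hao'
          rw [LegalTurn, inter_comm]
          exact hf.turn_legal o u q heo.symm heq hturn b a hb ha
            (seg_symm (f u) (f o) ▸ hbo) haq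

theorem iterate_mem (hf : IsTrainTrackMap V φ f lam) (n : ℕ) {v : T} (hv : v ∈ V) :
    f^[n] v ∈ V := by
  induction n with
  | zero => exact hv
  | succ n ih =>
    rw [Function.iterate_succ_apply']
    exact hf.map_vertex _ ih

/-- Every iterate of an edge joins its endpoints by a legal segment, so each further application of
`f` multiplies the length by exactly `lam`. -/
theorem dist_iterate_eq (hf : IsTrainTrackMap V φ f lam) (hT : IsSimplicialTree T V) (n : ℕ)
    {u v x y : T} (he : IsEdge V u v) (hx : x ∈ seg u v) (hy : y ∈ seg u v) :
    dist (f^[n] x) (f^[n] y) = lam ^ n * dist x y := by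
  have key : dist (f^[n] u) (f^[n] v) = lam ^ n * dist u v ∧
      LegalSeg V f (f^[n] u) (f^[n] v) := by
    induction n with
    | zero => exact ⟨by simp, legalSeg_of_isEdge hT he⟩
    | succ n ih =>
      have := hf.dist_map_and_legalSeg_map hT (hf.iterate_mem n he.left_mem)
        (hf.iterate_mem n he.right_mem) ih.2
      rw [Function.iterate_succ_apply', Function.iterate_succ_apply', pow_succ', mul_assoc,
        ← ih.1]
      exact this
  exact dist_eq_of_scaling hT.isRTree (hf.dist_iterate_le hT n) key.1 hx hy

end IsTrainTrackMap

end TrainTrack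

/-! ### The limiting tree -/

section Limit

variable {G : Type*} [Group G] {T : Type*} [MetricSpace T] [MulAction G T] [IsIsometricSMul G T]
  {V : Set T} {φ : G →* G} {f : T → T} {lam : ℝ}

namespace IsTrainTrackMap

omit [IsIsometricSMul G T] in
theorem scaledDist_le (hf : IsTrainTrackMap V φ f lam) (hT : IsSimplicialTree T V) (n : ℕ)
    (x y : T) : scaledDist f lam n x y ≤ dist x y := by
  rw [scaledDist, div_le_iff₀' (pow_pos hf.lam_pos n)]
  exact hf.dist_iterate_le hT n x y

omit [IsIsometricSMul G T] in
theorem scaledDist_eq (hf : IsTrainTrackMap V φ f lam) (hT : IsSimplicialTree T V) (n : ℕ)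
    {u v x y : T} (he : IsEdge V u v) (hx : x ∈ seg u v) (hy : y ∈ seg u v) :
    scaledDist f lam n x y = dist x y := by
  rw [scaledDist, div_eq_iff (pow_pos hf.lam_pos n).ne', mul_comm]
  exact hf.dist_iterate_eq hT n he hx hy

omit [IsIsometricSMul G T] in
theorem limitsExist (hf : IsTrainTrackMap V φ f lam) (hT : IsSimplicialTree T V) :
    LimitsExist f lam := by
  intro x y
  refine ⟨_, tendsto_atTop_ciInf (antitone_nat_of_succ_le fun n => ?_) ⟨0, ?_⟩⟩
  · have hp := pow_pos hf.lam_pos n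
    rw [scaledDist, scaledDist, pow_succ', div_le_div_iff₀ (mul_pos hf.lam_pos hp) hp,
      Function.iterate_succ_apply', Function.iterate_succ_apply']
    have := mul_le_mul_of_nonneg_right (hf.dist_map_le hT (f^[n] x) (f^[n] y)) hp.le
    linarith
  · rintro _ ⟨n, rfl⟩
    exact div_nonneg dist_nonneg (pow_pos hf.lam_pos n).le

omit [IsIsometricSMul G T] in
-- The bound is uniform in `n`, so a convergent sequence of points can be replaced by its limit
-- inside `d_n`.
theorem abs_scaledDist_sub_le (hf : IsTrainTrackMap V φ f lam) (hT : IsSimplicialTree T V)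
    (n : ℕ) (x y z : T) : |scaledDist f lam n x y - scaledDist f lam n x z| ≤ dist y z := by
  refine le_trans ?_ (hf.scaledDist_le hT n y z)
  have hp := pow_pos hf.lam_pos n
  rw [scaledDist, scaledDist, scaledDist, ← sub_div, abs_div, abs_of_pos hp, dist_comm _ (f^[n] y),
    dist_comm _ (f^[n] z)]
  exact div_le_div_of_nonneg_right (abs_dist_sub_le _ _ _) hp.le

omit [IsIsometricSMul G T] in
theorem limDist_eq (hf : IsTrainTrackMap V φ f lam) (hT : IsSimplicialTree T V)
    {u v x y : T} (he : IsEdge V u v) (hx : x ∈ seg u v) (hy : y ∈ seg u v) :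
    limDist f lam x y = dist x y := by
  refine tendsto_nhds_unique ((hf.limitsExist hT).tendsto x y) ?_
  simp only [hf.scaledDist_eq hT _ he hx hy]
  exact tendsto_const_nhds

omit [IsIsometricSMul G T] in
/-- The geodesic of `T_∞` joining the images of `x` and `y` lies in the image of `seg x y`. -/
theorem exists_limDist_eq (hf : IsTrainTrackMap V φ f lam) (hT : IsSimplicialTree T V)
    (x y : T) {t : ℝ} (h0 : 0 ≤ t) (h1 : t ≤ limDist f lam x y) :
    ∃ z ∈ seg x y, limDist f lam x z = t ∧ limDist f lam z y = limDist f lam x y - t := by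
  have hlim := hf.limitsExist hT
  -- A ratio rather than a distance is fixed, because `d_n(x, y)` varies with `n`. If `d_∞(x, y) =
  -- 0`, any ratio would do.
  obtain ⟨θ, hθ0, hθ1, hθ⟩ : ∃ θ : ℝ, 0 ≤ θ ∧ θ ≤ 1 ∧ θ * limDist f lam x y = t := by
    rcases (h0.trans h1).eq_or_lt with hD | hD
    · exact ⟨0, le_rfl, zero_le_one, by rw [zero_mul]; linarith⟩
    · exact ⟨t / limDist f lam x y, div_nonneg h0 hD.le, (div_le_one hD).2 h1,
        div_mul_cancel₀ _ hD.ne'⟩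
  have hz : ∀ n, ∃ z ∈ seg x y, scaledDist f lam n x z = θ * scaledDist f lam n x y ∧
      scaledDist f lam n z y = (1 - θ) * scaledDist f lam n x y := by
    intro n
    obtain ⟨r, hr, hxr⟩ := hT.isRTree.exists_mem_seg (f^[n] x) (f^[n] y)
      (t := θ * dist (f^[n] x) (f^[n] y)) (mul_nonneg hθ0 dist_nonneg)
      (mul_le_of_le_one_left dist_nonneg hθ1)
    obtain ⟨z, hz, rfl⟩ := hf.exists_of_mem_seg_iterate hT n hr
    rw [mem_seg, hxr] at hr
    refine ⟨z, hz, ?_, ?_⟩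
    · rw [scaledDist, scaledDist, hxr, mul_div_assoc]
    · rw [scaledDist, scaledDist, ← mul_div_assoc]
      congr 1
      linarith
  choose z hzs hz1 hz2 using hz
  obtain ⟨a, ha, ψ, hψ, hψa⟩ := (hT.isRTree.isCompact_seg x y).tendsto_subseq hzs
  have hda : Tendsto (fun n => dist (z (ψ n)) a) atTop (𝓝 0) := tendsto_iff_dist_tendsto_zero.1 hψa
  have hD := (hlim.tendsto x y).comp hψ.tendsto_atTop
  refine ⟨a, ha, ?_, ?_⟩
  · refine tendsto_nhds_unique ((hlim.tendsto x a).comp hψ.tendsto_atTop) ?_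
    have h := hD.const_mul θ
    rw [hθ] at h
    have h' : Tendsto (fun n => scaledDist f lam (ψ n) x a - θ * scaledDist f lam (ψ n) x y)
        atTop (𝓝 0) := by
      refine squeeze_zero_norm (fun n => ?_) hda
      rw [← hz1, Real.norm_eq_abs, dist_comm]
      exact hf.abs_scaledDist_sub_le hT _ _ _ _
    simpa [Function.comp_def] using h'.add h
  · refine tendsto_nhds_unique ((hlim.tendsto a y).comp hψ.tendsto_atTop) ?_
    have h := hD.const_mul (1 - θ)
    rw [sub_mul, hθ, one_mul] at h
    have h' : Tendsto
        (fun n => scaledDist f lam (ψ n) a y - (1 - θ) * scaledDist f lam (ψ n) x y)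
        atTop (𝓝 0) := by
      refine squeeze_zero_norm (fun n => ?_) hda
      have hs : ∀ m (p q : T), scaledDist f lam m p q = scaledDist f lam m q p := by
        intro m p q
        rw [scaledDist, scaledDist, dist_comm]
      rw [← hz2, Real.norm_eq_abs, dist_comm, hs _ a, hs _ _ y]
      exact hf.abs_scaledDist_sub_le hT _ _ _ _
    simpa [Function.comp_def] using h'.add h

end IsTrainTrackMap

/-- The projection `T → T_∞`. -/
noncomputable def LimitTree.proj (hf : IsTrainTrackMap V φ f lam) (hlim : LimitsExist f lam) (x : T) :
    LimitTree hf hlim :=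
  SeparationQuotient.mk (X := PreLimitTree hf hlim) x

namespace LimitTree

variable (hf : IsTrainTrackMap V φ f lam) (hlim : LimitsExist f lam)

omit [IsIsometricSMul G T] in
theorem proj_surjective : Function.Surjective (proj hf hlim) :=
  SeparationQuotient.surjective_mk (X := PreLimitTree hf hlim)

omit [IsIsometricSMul G T] in
theorem dist_proj (x y : T) : dist (proj hf hlim x) (proj hf hlim y) = limDist f lam x y :=
  SeparationQuotient.dist_mk (α := PreLimitTree hf hlim) x y

theorem smul_proj (g : G) (x : T) : g • proj hf hlim x = proj hf hlim (g • x) :=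
  (SeparationQuotient.mk_smul (X := PreLimitTree hf hlim) g x).symm

omit [IsIsometricSMul G T] in
theorem isRTree (hT : IsSimplicialTree T V) : IsRTree (LimitTree hf hlim) := by
  refine IsRTree.of_exists_mem_seg ?_ ?_ ?_
  · exact hT.isRTree.nonempty.map (proj hf hlim)
  · intro X Y t ht
    obtain ⟨x, rfl⟩ := proj_surjective hf hlim X
    obtain ⟨y, rfl⟩ := proj_surjective hf hlim Y
    rw [dist_proj] at ht
    obtain ⟨z, -, h1, h2⟩ := hf.exists_limDist_eq hT x y ht.1 ht.2
    refine ⟨proj hf hlim z, ?_, by rw [dist_proj, h1]⟩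
    rw [mem_seg, dist_proj, dist_proj, dist_proj, h1, h2]
    ring
  · intro X Y Z W
    obtain ⟨x, rfl⟩ := proj_surjective hf hlim X
    obtain ⟨y, rfl⟩ := proj_surjective hf hlim Y
    obtain ⟨z, rfl⟩ := proj_surjective hf hlim Z
    obtain ⟨w, rfl⟩ := proj_surjective hf hlim W
    simp only [dist_proj]
    refine le_of_tendsto_of_tendsto' ((hlim.tendsto x y).add (hlim.tendsto z w))
      (((hlim.tendsto x z).add (hlim.tendsto y w)).max
        ((hlim.tendsto x w).add (hlim.tendsto y z))) fun n => ?_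
    have hp := pow_pos hf.lam_pos n
    simp only [scaledDist, ← add_div, max_div_div_right hp.le]
    exact div_le_div_of_nonneg_right (hT.isRTree.four_point _ _ _ _) hp.le

end LimitTree

end Limit

/-! ### Stabilizers -/

section Stabilizers

variable {G : Type*} [Group G] {T : Type*} [MetricSpace T] [MulAction G T] [IsIsometricSMul G T]
  {V : Set T} {φ : G →* G} {f : T → T} {lam : ℝ}

theorem IsRTree.smul_eq_of_mem_seg (hX : IsRTree T) {x y z : T} {g : G} (hx : g • x = x)
    (hy : g • y = y) (hz : z ∈ seg x y) : g • z = z := by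
  have h := smul_mem_seg g hz
  rw [hx, hy] at h
  refine hX.eq_of_mem_seg h hz ?_
  rw [← dist_smul g x z, hx]

theorem IsEdge.smul {p : ℕ} {H : Fin p → Subgroup G} (hT : IsOuterSpaceTree H T V) (g : G)
    {u v : T} (he : IsEdge V u v) : IsEdge V (g • u) (g • v) := by
  refine isEdge_of_forall (hT.smul_vertex g u he.left_mem) (hT.smul_vertex g v he.right_mem)
    (fun h => he.1 (smul_left_cancel g h)) fun w hw hwV => ?_
  have h := smul_mem_seg g⁻¹ hw
  rw [inv_smul_smul, inv_smul_smul] at h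
  rw [← inv_smul_eq_iff, ← inv_smul_eq_iff]
  exact he.eq_or_eq (hT.smul_vertex g⁻¹ w hwV) h

/-- An element fixing two distinct points of a tree in outer space is trivial. -/
theorem IsOuterSpaceTree.eq_one_of_fixes {p : ℕ} {H : Fin p → Subgroup G}
    (hT : IsOuterSpaceTree H T V) {x y : T} {g : G} (hne : x ≠ y) (hx : g • x = x)
    (hy : g • y = y) : g = 1 := by
  have hR := hT.simplicial.isRTree
  revert hne hx hy
  refine hT.simplicial.seg_induction (P := fun x y => x ≠ y → g • x = x → g • y = y → g = 1)
    (fun x h => absurd rfl h) ?_ ?_ x y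
  · intro u v x y he hxe hye hne hx hy
    have hd := dist_pos.2 hne
    -- The midpoint `r` is fixed by `g` and is interior to the edge, so `g` preserves the edge.
    obtain ⟨r, hr, hxr⟩ := hR.exists_mem_seg x y (t := dist x y / 2) (by linarith) (by linarith)
    have hrg := hR.smul_eq_of_mem_seg hx hy hr
    have hends : ∀ a b, IsEdge V a b → x ∈ seg a b → y ∈ seg a b → r ≠ a := by
      rintro a b - hxa hya rfl
      have h := hR.dist_le_of_mem_seg hxa hya
      rw [mem_seg] at hr
      rw [dist_comm r x, abs_sub_comm] at h
      have : |dist r y - dist x r| = 0 := by rw [abs_eq_zero]; linarith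
      linarith
    have hre : r ∈ seg u v := by
      rcases hR.mem_seg_or u hr with h | h
      · exact seg_subset_left hxe (seg_symm x u ▸ h)
      · exact seg_subset_left hye h
    have hrV : r ∉ V := fun h => by
      rcases he.eq_or_eq h hre with e | e
      · exact hends u v he hxe hye e
      · exact hends v u he.symm (seg_symm u v ▸ hxe) (seg_symm u v ▸ hye) e
    have hseg := hT.simplicial.edge_unique r hrV u v _ _ he (he.smul hT g) hre
      (by have := smul_mem_seg g hre; rwa [hrg] at this)
    have hgu : g • u ∈ seg u v := hseg ▸ left_mem_seg _ _
    have hgv : g • v ∈ seg u v := hseg ▸ right_mem_seg _ _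
    rcases he.eq_or_eq (hT.smul_vertex g u he.left_mem) hgu with e | e
    · rcases he.eq_or_eq (hT.smul_vertex g v he.right_mem) hgv with e' | e'
      · exact absurd (smul_left_cancel g (e.trans e'.symm)) he.1
      · exact hT.edge_stabilizer u v he g e e'
    -- If `g` swaps the endpoints, its only possible fixed point on the edge is the midpoint, but
    -- `x` and `y` are both fixed.
    · have hmid : ∀ z ∈ seg u v, g • z = z → dist u z = dist u v / 2 := by
        intro z hz hgz
        have h := dist_smul g u z
        rw [e, hgz, dist_comm] at h
        rw [mem_seg] at hz
        linarith
      exact absurd (hR.eq_of_mem_seg hxe hye ((hmid x hxe hx).trans (hmid y hye hy).symm)) hne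
  · intro x y z hy h1 h2 hne hx hz
    have hgy := hR.smul_eq_of_mem_seg hx hz hy
    by_cases hxy : x = y
    · subst hxy
      exact h2 hne hx hz
    · exact h1 hxy hx hgy

/-- If `g` fixes in `T_∞` the images of two distinct points of an edge, then `g` is trivial. -/
theorem IsOuterSpaceTree.eq_one_of_fixes_edge_points {p : ℕ} {H : Fin p → Subgroup G}
    (hT : IsOuterSpaceTree H T V) (hφ : Function.Injective φ) (hf : IsTrainTrackMap V φ f lam)
    (hlim : LimitsExist f lam) {u v x y : T} {g : G} (he : IsEdge V u v) (hx : x ∈ seg u v)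
    (hy : y ∈ seg u v) (hne : x ≠ y)
    (hgx : g • LimitTree.proj hf hlim x = LimitTree.proj hf hlim x)
    (hgy : g • LimitTree.proj hf hlim y = LimitTree.proj hf hlim y) : g = 1 := by
  have hS := hT.simplicial
  have hR := hS.isRTree
  have hL := dist_pos.2 hne
  have hsub : seg x y ⊆ seg u v := by
    intro w hw
    rcases hR.mem_seg_or u hw with h | h
    · exact seg_subset_left hx (seg_symm x u ▸ h)
    · exact seg_subset_left hy h
  have hzero : ∀ z, g • LimitTree.proj hf hlim z = LimitTree.proj hf hlim z →
      Tendsto (fun n => scaledDist f lam n z (g • z)) atTop (𝓝 0) := by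
    intro z hz
    have h := hlim.tendsto z (g • z)
    rwa [← LimitTree.dist_proj hf hlim, ← LimitTree.smul_proj, hz, dist_self] at h
  -- A displacement below a quarter of the length leaves the middle half of `[x, y]` to work with.
  obtain ⟨n, hn1, hn2⟩ := (((hzero x hgx).eventually_lt_const
    (show 0 < dist x y / 4 by linarith)).and ((hzero y hgy).eventually_lt_const
    (show 0 < dist x y / 4 by linarith))).exists
  have hp := pow_pos hf.lam_pos n
  rw [scaledDist, div_lt_iff₀' hp, hf.iterate_smul] at hn1 hn2
  have hmid : ∀ z ∈ seg x y, dist x y / 4 < dist x z → dist x y / 4 < dist z y →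
      (φ^[n] g) • f^[n] z = f^[n] z := by
    intro z hz hxz hzy
    have hgz : g • LimitTree.proj hf hlim z = LimitTree.proj hf hlim z := by
      refine (LimitTree.isRTree hf hlim hS).smul_eq_of_mem_seg hgx hgy ?_
      rw [mem_seg, LimitTree.dist_proj, LimitTree.dist_proj, LimitTree.dist_proj,
        hf.limDist_eq hS he hx (hsub hz), hf.limDist_eq hS he (hsub hz) hy,
        hf.limDist_eq hS he hx hy]
      exact hz
    have hfz : f^[n] z ∈ seg (f^[n] x) (f^[n] y) :=
      mem_seg_of_scaling (hf.dist_iterate_le hS n) (hf.dist_iterate_eq hS n he hx hy) hz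
    have hmem : (φ^[n] g) • f^[n] z ∈ seg (f^[n] x) (f^[n] y) := by
      refine hR.mem_seg_of_dist_lt (smul_mem_seg (φ^[n] g) hfz) ?_ ?_
      · rw [dist_comm, dist_smul, hf.dist_iterate_eq hS n he hx (hsub hz)]
        exact hn1.trans (mul_lt_mul_of_pos_left hxz hp)
      · rw [dist_comm, dist_smul, hf.dist_iterate_eq hS n he (hsub hz) hy]
        exact hn2.trans (mul_lt_mul_of_pos_left hzy hp)
    obtain ⟨z', hz', hzz'⟩ := hf.exists_of_mem_seg_iterate hS n hmem
    -- The points `g • z` and `z'` have the same image under `fⁿ`, hence under all later iterates,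
    -- while `z` and `z'` lie in one edge, whose scaled distances are constant.
    have hev : ∀ m, scaledDist f lam (m + n) z (g • z) = dist z z' := by
      intro m
      rw [← hf.scaledDist_eq hS (m + n) he (hsub hz) (hsub hz'), scaledDist, scaledDist,
        Function.iterate_add_apply f m n (g • z), hf.iterate_smul, ← hzz',
        ← Function.iterate_add_apply f m n z']
    have h := (hzero z hgz).comp (tendsto_add_atTop_nat n)
    have h0 : dist z z' = 0 := by
      refine tendsto_nhds_unique ?_ h
      simp only [Function.comp_def, hev]
      exact tendsto_const_nhds
    rw [← hzz', dist_eq_zero.1 h0]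
  -- The fractions `1/2` and `1/3` give two different points at more than a quarter of the length
  -- from both ends.
  obtain ⟨a, ha, hxa⟩ := hR.exists_mem_seg x y (t := dist x y / 2) (by linarith) (by linarith)
  obtain ⟨b, hb, hxb⟩ := hR.exists_mem_seg x y (t := dist x y / 3) (by linarith) (by linarith)
  have hab : a ≠ b := by
    rintro rfl
    linarith
  have hfa := hmid a ha (by linarith) (by rw [mem_seg] at ha; linarith)
  have hfb := hmid b hb (by linarith) (by rw [mem_seg] at hb; linarith)
  have hfab : f^[n] a ≠ f^[n] b := by
    rw [← dist_pos, hf.dist_iterate_eq hS n he (hsub ha) (hsub hb)]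
    exact mul_pos hp (dist_pos.2 hab)
  have h1 := hT.eq_one_of_fixes hfab hfa hfb
  exact hφ.iterate n (by rw [h1, Function.iterate_fixed (map_one φ)])

theorem IsOuterSpaceTree.hasTrivialArcStabilizers_limitTree {p : ℕ} {H : Fin p → Subgroup G}
    (hT : IsOuterSpaceTree H T V) (hφ : Function.Injective φ) (hf : IsTrainTrackMap V φ f lam)
    (hlim : LimitsExist f lam) : HasTrivialArcStabilizers G (LimitTree hf hlim) := by
  rintro _ ⟨γ, -, hinj, rfl⟩
  rw [eq_bot_iff]
  intro g hg
  rw [mem_fixingSubgroup_iff] at hg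
  have hS := hT.simplicial
  obtain ⟨x, hx⟩ := LimitTree.proj_surjective hf hlim (γ 0)
  obtain ⟨y, hy⟩ := LimitTree.proj_surjective hf hlim (γ 1)
  have hgx : g • LimitTree.proj hf hlim x = LimitTree.proj hf hlim x := hx ▸ hg _ ⟨0, rfl⟩
  have hgy : g • LimitTree.proj hf hlim y = LimitTree.proj hf hlim y := hy ▸ hg _ ⟨1, rfl⟩
  have hD : 0 < limDist f lam x y := by
    rw [← LimitTree.dist_proj hf hlim, dist_pos, hx, hy]
    exact fun h => zero_ne_one (hinj h)
  have : Nonempty T := ⟨x⟩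
  choose! ζ hζ1 hζ2 hζ3 using fun t (ht : t ∈ Icc 0 (limDist f lam x y)) =>
    hf.exists_limDist_eq hS x y ht.1 ht.2
  -- The lift `ζ t` determines `t` as its `d_∞`-distance from `x`, so the lifts form an infinite
  -- subset of `seg x y`.
  have hζinj : InjOn ζ (Icc 0 (limDist f lam x y)) := by
    intro s hs t ht h
    rw [← hζ2 s hs, ← hζ2 t ht, h]
  obtain ⟨u, v, he, _, ⟨s, hs, rfl⟩, _, ⟨t, ht, rfl⟩, hne, hsu, htu⟩ :=
    hS.exists_edge_of_infinite ((Icc_infinite hD).image hζinj)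
      (image_subset_iff.2 fun t ht => hζ1 t ht)
  have hfix : ∀ t ∈ Icc 0 (limDist f lam x y),
      g • LimitTree.proj hf hlim (ζ t) = LimitTree.proj hf hlim (ζ t) := by
    intro t ht
    refine (LimitTree.isRTree hf hlim hS).smul_eq_of_mem_seg hgx hgy ?_
    rw [mem_seg, LimitTree.dist_proj, LimitTree.dist_proj, LimitTree.dist_proj, hζ2 t ht,
      hζ3 t ht]
    ring
  exact hT.eq_one_of_fixes_edge_points hφ hf hlim he hsu htu hne (hfix s hs) (hfix t ht)

end Stabilizers

theorem mainTheorem4 {G : Type*} [Group G] {p k : ℕ} (H : Fin p → Subgroup G)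
    (hG : IsFreeProductDecomposition H k)
    {T : Type*} [MetricSpace T] [MulAction G T] [IsIsometricSMul G T] (V : Set T)
    (hT : IsOuterSpaceTree H T V)
    (φ : G →* G) (hφ : Function.Injective φ)
    (f : T → T) (lam : ℝ) (hf : IsTrainTrackMap V φ f lam) :
    ∃ hlim : LimitsExist f lam,
      IsRTree (LimitTree hf hlim) ∧ HasTrivialArcStabilizers G (LimitTree hf hlim) :=
  ⟨hf.limitsExist hT.simplicial, LimitTree.isRTree hf _ hT.simplicial,
    hT.hasTrivialArcStabilizers_limitTree hφ hf _⟩
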